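/- Let $D$ be an integral domain with quotient field $K$. For $D$-submodules $A,B$ of $K$ put $(A:B)=\{x\in K: xB\subseteq A\}$. For a nonzero fractional ideal $I$ of $D$ let $I^{-1}=(D:I)$, $I_v=(I^{-1})^{-1}$ and $I_t=\bigcup J_v$, where $J$ ranges over the finitely generated subideals of $I$. A nonzero ideal $I$ of $D$ is a $t$-ideal if $I_t=I$; it is $t$-idempotent if moreover $(I^2)_t=I$. A $t$-prime ideal is a prime $t$-ideal, and a $t$-maximal ideal is a maximal element of the set of proper $t$-ideals of $D$ (such an ideal is prime). The domain $D$ is a Krull-type domain if $D_M$ is a valuation domain for every $t$-maximal ideal $M$ and every proper $t$-ideal is contained in only finitely many $t$-maximal ideals; it is a Prüfer domain if every nonzero finitely generated ideal is invertible. An overring $T$ of $D$ (that is, a ring with $D\subseteq T\subseteq K$) is fractional if it is a fractional ideal of $D$, and $t$-linked over $D$ if $I^{-1}=D$ implies $(T:IT)=T$ for every finitely generated ideal $I$ of $D$. **Lemma.** Let $V$ be a valuation domain that is not a field, $X$ an indeterminate over $V$, and $R:=V[X]$. Then: 1. $R$ is a Krull-type domain which is not a Prüfer domain. 2. An overring $T$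 of $R$ is fractional and $t$-linked over $R$ if and only if $T=V_p[X]$ for some nonzero prime ideal $p$ of $V$. 3. An ideal $P$ of $R$ is a $t$-idempotent $t$-prime ideal if and only if $P=p[X]$ for some nonzero prime ideal $p$ of $V$ with $p^2=p$. -/

import Mathlib

open Polynomial
open scoped nonZeroDivisors

namespace TOp

section Closure

variable {R K : Type*} [CommRing R] [Field K] [Algebra R K]

/-- The `v`-closure `I_v = (I⁻¹)⁻¹`, where `I⁻¹ = (R : I) = {x ∈ K | x I ⊆ R}`.
Here `1 : Submodule R K` is the image of `R` in its quotient field `K`, and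
`A / B = (A : B) = {x ∈ K | x B ⊆ A}`. -/
noncomputable def vClosure (I : Submodule R K) : Submodule R K := 1 / (1 / I)

theorem vClosure_mono {I J : Submodule R K} (h : I ≤ J) : vClosure I ≤ vClosure J := by
  intro x hx
  rw [vClosure, Submodule.mem_div_iff_forall_mul_mem] at hx ⊢
  intro y hy
  refine hx y ?_
  rw [Submodule.mem_div_iff_forall_mul_mem] at hy ⊢
  exact fun z hz => hy z (h hz)

/-- The `t`-closure `I_t`: the union of the `J_v`, where `J` ranges over the finitely generated
`R`-submodules of `I`. It is used for nonzero `I` only (for those, `J = 0` adds nothing). -/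
noncomputable def tClosure (I : Submodule R K) : Submodule R K where
  carrier := {x | ∃ J : Submodule R K, J.FG ∧ J ≤ I ∧ x ∈ vClosure J}
  zero_mem' := ⟨⊥, Submodule.fg_bot, bot_le, zero_mem _⟩
  add_mem' := by
    rintro x y ⟨J, hJ, hJI, hx⟩ ⟨L, hL, hLI, hy⟩
    exact ⟨J ⊔ L, hJ.sup hL, sup_le hJI hLI,
      add_mem (vClosure_mono le_sup_left hx) (vClosure_mono le_sup_right hy)⟩
  smul_mem' := by
    rintro c x ⟨J, hJ, hJI, hx⟩
    exact ⟨J, hJ, hJI, Submodule.smul_mem _ c hx⟩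

end Closure

section Ideals

variable {R : Type*} (K : Type*) [CommRing R] [Field K] [Algebra R K]

/-- A (nonzero) ideal `I` of `R` is a `t`-ideal if `I_t = I`. -/
def IsTIdeal (I : Ideal R) : Prop :=
  I ≠ ⊥ ∧ tClosure (IsLocalization.coeSubmodule K I) = IsLocalization.coeSubmodule K I

/-- A `t`-prime ideal is a prime ideal that is a `t`-ideal. -/
def IsTPrime (P : Ideal R) : Prop := P.IsPrime ∧ IsTIdeal K P

/-- A `t`-maximal ideal is a maximal element of the set of proper `t`-ideals. -/
def IsTMaximal (M : Ideal R) : Prop := Maximal (fun I : Ideal R => I ≠ ⊤ ∧ IsTIdeal K I) M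

/-- A `t`-ideal `I` is `t`-idempotent if `(I²)_t = I`. -/
def IsTIdempotent (I : Ideal R) : Prop :=
  IsTIdeal K I ∧ tClosure (IsLocalization.coeSubmodule K (I ^ 2)) = IsLocalization.coeSubmodule K I

end Ideals

section Rings

variable (R K : Type*) [CommRing R] [IsDomain R] [Field K] [Algebra R K] [IsFractionRing R K]

/-- Prüfer `v`-multiplication domain: the localization at each `t`-maximal ideal (such an ideal is
prime) is a valuation domain. -/
def IsPVMD : Prop :=
  ∀ M : Ideal R, IsTMaximal K M → ∃ _ : M.IsPrime, ValuationRing (Localization.AtPrime M)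

/-- Finite `t`-character: each proper `t`-ideal is contained in only finitely many
`t`-maximal ideals. -/
def HasFiniteTCharacter : Prop :=
  ∀ I : Ideal R, I ≠ ⊤ → IsTIdeal K I → {M : Ideal R | IsTMaximal K M ∧ I ≤ M}.Finite

/-- Krull-type domain: a PVMD of finite `t`-character. -/
def IsKrullType : Prop := IsPVMD R K ∧ HasFiniteTCharacter R K

/-- Prüfer domain: every nonzero finitely generated ideal is invertible. -/
def IsPrueferDomain : Prop :=
  ∀ I : Ideal R, I.FG → I ≠ ⊥ → IsUnit (I : FractionalIdeal R⁰ K)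

end Rings

section Overrings

variable {R K : Type*} [CommRing R] [Field K] [Algebra R K]

/-- An overring `T` of `R` (an `R`-subalgebra of the quotient field `K`) is `t`-linked over `R` if
`I⁻¹ = R` implies `(T : IT) = T`, for each finitely generated ideal `I` of `R`. -/
def IsTLinked (T : Subalgebra R K) : Prop :=
  ∀ I : Ideal R, I.FG → (1 : Submodule R K) / IsLocalization.coeSubmodule K I = 1 →
    Subalgebra.toSubmodule T / (IsLocalization.coeSubmodule K I * Subalgebra.toSubmodule T) =
      Subalgebra.toSubmodule T

/-- An overring `T` of `R` is fractional if it is a fractional ideal of `R`. -/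
def IsFractionalOverring (T : Subalgebra R K) : Prop :=
  IsFractional R⁰ (Subalgebra.toSubmodule T)

end Overrings

section Polynomial

variable {V : Type*} (K : Type*) [CommRing V] [Field K] [Algebra V[X] K]
  [IsFractionRing V[X] K]

theorem isUnit_const (p : Ideal V) [p.IsPrime] (s : p.primeCompl) :
    IsUnit (((algebraMap V[X] K).comp (C : V →+* V[X])) (s : V)) := by
  refine IsUnit.mk0 _ fun h => s.2 ?_
  rw [RingHom.comp_apply, map_eq_zero_iff _ (IsFractionRing.injective V[X] K), C_eq_zero] at h
  rw [h]
  exact p.zero_mem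

/-- The canonical embedding of `V_p[X]` in the quotient field `K` of `V[X]`: the constants
`V_p → K` extend `V → V[X] → K`, and the variable goes to `X`. -/
noncomputable def localizedPolynomialMap (p : Ideal V) [p.IsPrime] :
    (Localization.AtPrime p)[X] →+* K :=
  eval₂RingHom (IsLocalization.lift (M := p.primeCompl) (isUnit_const K p)) (algebraMap V[X] K X)

/-- `V_p[X]` as a subring of the quotient field `K` of `V[X]`. -/
noncomputable def localizedPolynomialRing (p : Ideal V) [p.IsPrime] : Subring K :=
  (localizedPolynomialMap K p).range

end Polynomial

end TOp

/-!
Every nonzero polynomial over the valuation domain `V` is `C c * g` with `g` primitive, that is,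
with a unit coefficient, and by Gauss's lemma a primitive `g` and a nonzero constant `a` satisfy
`(g, a)⁻¹ = V[X]` (`one_div_coeSubmodule_span_pair`). So a proper `t`-ideal cannot contain both
kinds of elements. Conversely, a nonzero ideal any two elements of which have a common divisor in
the ideal is a `t`-ideal (`tClosure_coeSubmodule_eq_of_directed`); this applies to principal ideals
and to the ideals extended from `V`. Hence a `t`-prime is either `p[X]` with `p` a nonzero prime of
`V`, or, when it contains no nonzero constant, it is generated by a primitive polynomial of positive
degree (`IsTPrime.eq_map_C_or_eq_span_singleton`).

The statements on ideals follow. The `t`-maximal ideals are among `m[X]`, for the maximal ideal `m`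
of `V`, and principal primes; both kinds have valuation rings as localizations, and a nonzero
polynomial lies in finitely many of them. The ideal `(X, a)`, for a nonzero nonunit `a` of `V`, is
proper with inverse `V[X]`, hence not invertible. The square of `p[X]` is the `t`-ideal `p²[X]`, and
the square of `(g)` is the `t`-ideal `(g²)`, which differs from `(g)`.

For overrings: if `T` is fractional, then its elements are almost integral over `V[X]`, and a
descent on degrees shows that their denominators may be taken in `V`
(`exists_mul_C_eq_of_forall_mul_pow`). So each element outside `V[X]` is `g / a` with `g` primitive
and `a` in `V`, and `t`-linkedness applied to `(g, a)` puts `1 / a` in `T` (`IsTLinked.inv_mem`).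
Thus `T` is `V_p[X]`, where `p` is the prime ideal of the constants that are not invertible in `T`.
Conversely, any nonzero element of `p` is a common denominator of `V_p[X]`, and finitely many
denominators outside `p` have a common multiple outside `p`, whence `V_p[X]` is `t`-linked.
-/

namespace TOp

open IsLocalization (coeSubmodule mem_coeSubmodule)

/-! ### `t`-closures over an arbitrary domain -/

section General

variable {R K : Type*} [CommRing R] [Field K] [Algebra R K]

theorem le_vClosure (I : Submodule R K) : I ≤ vClosure I := fun x hx y hy =>
  mul_comm x y ▸ hy x hx

theorem le_tClosure (I : Submodule R K) : I ≤ tClosure I := fun x hx =>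
  ⟨Submodule.span R {x}, Submodule.fg_span_singleton x,
    (Submodule.span_singleton_le_iff_mem x I).2 hx,
    le_vClosure _ (Submodule.mem_span_singleton_self x)⟩

theorem mem_coeSubmodule_span_singleton {c : R} {x : K} :
    x ∈ coeSubmodule K (Ideal.span {c}) ↔ ∃ r, x = algebraMap R K (c * r) := by
  simp only [mem_coeSubmodule, Ideal.mem_span_singleton]
  constructor
  · rintro ⟨_, ⟨r, rfl⟩, rfl⟩
    exact ⟨r, rfl⟩
  · rintro ⟨r, rfl⟩
    exact ⟨_, ⟨r, rfl⟩, rfl⟩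

variable [IsFractionRing R K]

theorem algebraMap_mem_coeSubmodule {I : Ideal R} {x : R} :
    algebraMap R K x ∈ coeSubmodule K I ↔ x ∈ I := by
  rw [mem_coeSubmodule]
  refine ⟨?_, fun h => ⟨x, h, rfl⟩⟩
  rintro ⟨y, hy, h⟩
  rwa [← IsFractionRing.injective R K h]

theorem vClosure_coeSubmodule_span_singleton {c : R} (hc : c ≠ 0) :
    vClosure (coeSubmodule K (Ideal.span {c})) = coeSubmodule K (Ideal.span {c}) := by
  refine le_antisymm (fun x hx => ?_) (le_vClosure _)
  have hc' : algebraMap R K c ≠ 0 := by simpa using hc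
  have h : (algebraMap R K c)⁻¹ ∈ (1 : Submodule R K) / coeSubmodule K (Ideal.span {c}) := by
    intro y hy
    obtain ⟨r, rfl⟩ := mem_coeSubmodule_span_singleton.1 hy
    exact Submodule.mem_one.2 ⟨r, by simp [hc']⟩
  obtain ⟨r, hr⟩ := Submodule.mem_one.1 (hx _ h)
  exact mem_coeSubmodule_span_singleton.2 ⟨r, by rw [map_mul, hr]; field_simp⟩

/-- If any two elements of `I` have a common divisor in `I`, then every finitely generated subideal
lies in a principal one, and principal ideals are divisorial. -/
theorem tClosure_coeSubmodule_eq_of_directed [IsDomain R] {I : Ideal R} (h0 : I ≠ ⊥)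
    (hI : ∀ f ∈ I, ∀ g ∈ I, ∃ c ∈ I, c ∣ f ∧ c ∣ g) :
    tClosure (coeSubmodule K I) = coeSubmodule K I := by
  refine le_antisymm ?_ (le_tClosure _)
  rintro x ⟨J, ⟨s, rfl⟩, hJ, hx⟩
  -- the common divisor is taken nonzero, as the zero ideal need not be divisorial
  have key : ∀ s : Finset K, (s : Set K) ⊆ coeSubmodule K I →
      ∃ c ∈ I, c ≠ 0 ∧ (s : Set K) ⊆ coeSubmodule K (Ideal.span {c}) := by
    classical
    intro s
    induction s using Finset.induction_on with
    | empty =>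
      intro _
      obtain ⟨c, hc, hc0⟩ := Submodule.exists_mem_ne_zero_of_ne_bot h0
      exact ⟨c, hc, hc0, by simp⟩
    | insert y s _ ih =>
      intro hs
      rw [Finset.coe_insert, Set.insert_subset_iff] at hs
      obtain ⟨c, hc, hc0, hsc⟩ := ih hs.2
      obtain ⟨f, hf, rfl⟩ := (mem_coeSubmodule K I).1 hs.1
      obtain ⟨d, hd, hdf, hdc⟩ := hI f hf c hc
      refine ⟨d, hd, ne_zero_of_dvd_ne_zero hc0 hdc, ?_⟩
      rw [Finset.coe_insert, Set.insert_subset_iff]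
      exact ⟨algebraMap_mem_coeSubmodule.2 (Ideal.mem_span_singleton.2 hdf), hsc.trans
        (IsLocalization.coeSubmodule_mono K (Ideal.span_singleton_le_span_singleton.2 hdc))⟩
  obtain ⟨c, hc, hc0, hsc⟩ := key s (Submodule.span_le.1 hJ)
  have := vClosure_mono (Submodule.span_le.2 hsc) hx
  rw [vClosure_coeSubmodule_span_singleton hc0] at this
  exact IsLocalization.coeSubmodule_mono K ((Ideal.span_singleton_le_iff_mem I).2 hc) this

variable (K) in
theorem isTIdeal_span_singleton [IsDomain R] {f : R} (hf : f ≠ 0) :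
    IsTIdeal K (Ideal.span {f}) := by
  have h0 : Ideal.span {f} ≠ ⊥ := by simpa using hf
  refine ⟨h0, tClosure_coeSubmodule_eq_of_directed h0 fun g hg h hh => ?_⟩
  exact ⟨f, Ideal.mem_span_singleton_self f, Ideal.mem_span_singleton.1 hg,
    Ideal.mem_span_singleton.1 hh⟩

theorem IsTIdeal.eq_top_of_one_div_eq_one {I J : Ideal R} (hI : IsTIdeal K I) (hJ : J.FG)
    (hJI : J ≤ I) (h : (1 : Submodule R K) / coeSubmodule K J = 1) : I = ⊤ := by
  have h1 : (1 : K) ∈ tClosure (coeSubmodule K I) := by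
    refine ⟨coeSubmodule K J, Submodule.FG.map _ hJ, IsLocalization.coeSubmodule_mono K hJI, ?_⟩
    rw [vClosure, h]
    exact fun y hy => by simpa using hy
  rw [hI.2, ← map_one (algebraMap R K), mem_coeSubmodule] at h1
  obtain ⟨y, hy, h⟩ := h1
  rwa [IsFractionRing.injective R K h, ← Ideal.eq_top_iff_one] at hy

/-- For `y ∉ M` the ideal `(M : y)` is again a proper `t`-ideal, so it cannot be larger than `M`. -/
theorem IsTMaximal.isPrime {M : Ideal R} (hM : IsTMaximal K M) : M.IsPrime := by
  refine ⟨hM.prop.1, fun {x y} hxy => or_iff_not_imp_right.2 fun hy => ?_⟩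
  let L : Ideal R := Submodule.comap (LinearMap.mulLeft R y) M
  have hL : ∀ z, z ∈ L ↔ y * z ∈ M := fun z => Iff.rfl
  have hML : M ≤ L := fun z hz => M.mul_mem_left y hz
  have hL1 : L ≠ ⊤ := by
    rw [Ne, Ideal.eq_top_iff_one, hL, mul_one]
    exact hy
  have hL0 : L ≠ ⊥ := fun h => hM.prop.2.1 (le_bot_iff.1 (h ▸ hML))
  have hLt : tClosure (coeSubmodule K L) = coeSubmodule K L := by
    refine le_antisymm ?_ (le_tClosure _)
    rintro z ⟨J, hJ, hJL, hz⟩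
    obtain ⟨r, rfl⟩ : ∃ r, algebraMap R K r = z := by
      have hJ1 : J ≤ 1 := hJL.trans (by
        rw [← IsLocalization.coeSubmodule_top]
        exact IsLocalization.coeSubmodule_mono K le_top)
      have h1 := hz 1 (Submodule.one_le_one_div.2 hJ1 (Submodule.mem_one.2 ⟨1, map_one _⟩))
      simpa [Submodule.mem_one] using h1
    have hmem : algebraMap R K (y * r) ∈ tClosure (coeSubmodule K M) := by
      refine ⟨J.map (LinearMap.mulLeft R (algebraMap R K y)), hJ.map _, ?_, ?_⟩
      · rintro _ ⟨w, hw, rfl⟩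
        obtain ⟨l, hl, rfl⟩ := (mem_coeSubmodule K L).1 (hJL hw)
        simpa only [LinearMap.mulLeft_apply, ← map_mul] using
          (algebraMap_mem_coeSubmodule (K := K)).2 ((hL l).1 hl)
      · intro w hw
        rw [map_mul, mul_comm (algebraMap R K y), mul_assoc]
        refine hz _ fun j hj => ?_
        rw [mul_comm (algebraMap R K y), mul_assoc]
        exact hw _ ⟨j, hj, rfl⟩
    rw [hM.prop.2.2, algebraMap_mem_coeSubmodule] at hmem
    exact algebraMap_mem_coeSubmodule.2 hmem
  have hLM := hM.eq_of_ge (y := L) ⟨hL1, hL0, hLt⟩ hML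
  have hx : x ∈ L := by rw [hL, mul_comm]; exact hxy
  rwa [← hLM]

theorem IsTMaximal.isTPrime {M : Ideal R} (hM : IsTMaximal K M) : IsTPrime K M :=
  ⟨hM.isPrime, hM.prop.2⟩

end General

/-! ### Localizations that are valuation rings -/

theorem valuationRing_localization_atPrime {R : Type*} [CommRing R] [IsDomain R] (P : Ideal R)
    [P.IsPrime] (h : ∀ x y : R, ∃ s ∉ P, x ∣ s * y ∨ y ∣ s * x) :
    ValuationRing (Localization.AtPrime P) := by
  have key : ∀ (x y : R) (s t u : P.primeCompl), x ∣ (u : R) * y →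
      IsLocalization.mk' (Localization.AtPrime P) x s ∣
        IsLocalization.mk' (Localization.AtPrime P) y t := by
    rintro x y s t u ⟨z, hz⟩
    refine ⟨IsLocalization.mk' _ (z * s) (u * t), ?_⟩
    rw [← IsLocalization.mk'_mul, IsLocalization.mk'_eq_iff_eq]
    congr 1
    push_cast
    linear_combination ((s : R) * t) * hz
  rw [ValuationRing.iff_dvd_total]
  refine ⟨fun a b => ?_⟩
  obtain ⟨x, s, rfl⟩ := IsLocalization.exists_mk'_eq P.primeCompl a
  obtain ⟨y, t, rfl⟩ := IsLocalization.exists_mk'_eq P.primeCompl b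
  obtain ⟨u, hu, h | h⟩ := h x y
  · exact Or.inl (key x y s t ⟨u, hu⟩ h)
  · exact Or.inr (key y x t s ⟨u, hu⟩ h)

theorem valuationRing_localization_span_singleton {R : Type*} [CommRing R] [IsDomain R] (g : R)
    [hP : (Ideal.span {g}).IsPrime] (hfin : ∀ x : R, x ≠ 0 → FiniteMultiplicity g x) :
    ValuationRing (Localization.AtPrime (Ideal.span {g})) := by
  refine valuationRing_localization_atPrime _ fun x y => ?_
  have h1 : (1 : R) ∉ Ideal.span {g} := (Ideal.ne_top_iff_one _).1 hP.ne_top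
  by_cases hx : x = 0
  · exact ⟨1, h1, Or.inr (by simp [hx])⟩
  by_cases hy : y = 0
  · exact ⟨1, h1, Or.inl (by simp [hy])⟩
  obtain ⟨x', hx', hxg⟩ := (hfin x hx).exists_eq_pow_mul_and_not_dvd
  obtain ⟨y', hy', hyg⟩ := (hfin y hy).exists_eq_pow_mul_and_not_dvd
  rw [← Ideal.mem_span_singleton] at hxg hyg
  rcases le_total (multiplicity g x) (multiplicity g y) with h | h
  · obtain ⟨k, hk⟩ := pow_dvd_pow g h
    exact ⟨x', hxg, Or.inl ⟨k * y', by linear_combination x' * hy' - k * y' * hx' + x' * y' * hk⟩⟩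
  · obtain ⟨k, hk⟩ := pow_dvd_pow g h
    exact ⟨y', hyg, Or.inr ⟨k * x', by linear_combination y' * hx' - k * x' * hy' + x' * y' * hk⟩⟩

/-! ### Primitive polynomials -/

section Primitive

variable {V : Type*} [CommRing V]

theorem exists_eq_C_mul_isPrimitive [IsDomain V] [IsBezout V] (f : V[X]) :
    ∃ (c : V) (g : V[X]), g.IsPrimitive ∧ f = C c * g := by
  obtain ⟨_⟩ : Nonempty (NormalizedGCDMonoid V) := inferInstance
  exact ⟨f.content, f.primPart, f.isPrimitive_primPart, f.eq_C_content_mul_primPart⟩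

/-- A form of Gauss's lemma. -/
theorem C_dvd_of_C_dvd_isPrimitive_mul [IsDomain V] [IsBezout V] {a : V} {g h : V[X]}
    (hg : g.IsPrimitive) (hd : C a ∣ g * h) : C a ∣ h := by
  obtain ⟨_⟩ : Nonempty (NormalizedGCDMonoid V) := inferInstance
  rw [← dvd_content_iff_C_dvd] at hd ⊢
  rw [(associated_content_mul g h).dvd_iff_dvd_right, hg.content_eq_one, one_mul] at hd
  exact hd

theorem isPrimitive_dvd_of_dvd_C_mul [IsDomain V] [IsBezout V] {a : V} (ha : a ≠ 0) {g h : V[X]}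
    (hg : g.IsPrimitive) (hd : g ∣ C a * h) : g ∣ h := by
  obtain ⟨k, hk⟩ := hd
  obtain ⟨l, rfl⟩ := C_dvd_of_C_dvd_isPrimitive_mul hg (Dvd.intro _ hk)
  refine ⟨l, mul_left_cancel₀ (C_ne_zero.2 ha) ?_⟩
  rw [hk, mul_left_comm]

theorem exists_isUnit_coeff_of_isPrimitive [IsDomain V] [ValuationRing V] {g : V[X]}
    (hg : g.IsPrimitive) : ∃ n, IsUnit (g.coeff n) := by
  have htop := (Submodule.IsPrincipal.isPrimitive_iff_contentIdeal_eq_top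
    (IsBezout.isPrincipal_of_FG _ g.contentIdeal_FG)).1 hg
  by_contra! h
  refine (Ideal.IsPrime.ne_top (inferInstance : (IsLocalRing.maximalIdeal V).IsPrime))
    (top_le_iff.1 ?_)
  rw [← htop, contentIdeal_def, Ideal.span_le]
  intro c hc
  obtain ⟨n, -, rfl⟩ := mem_coeffs_iff.1 hc
  exact h n

theorem C_mul_mem_map_C_iff [IsDomain V] [ValuationRing V] {p : Ideal V} {c : V} {g : V[X]}
    (hg : g.IsPrimitive) : C c * g ∈ p.map (C : V →+* V[X]) ↔ c ∈ p := by
  refine ⟨fun h => ?_, fun h => Ideal.mul_mem_right _ _ (Ideal.mem_map_of_mem C h)⟩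
  obtain ⟨n, hn⟩ := exists_isUnit_coeff_of_isPrimitive hg
  have := Ideal.mem_map_C_iff.1 h n
  rwa [coeff_C_mul, mul_comm, Ideal.unit_mul_mem_iff_mem _ hn] at this

theorem C_mem_map_C_iff {p : Ideal V} {c : V} : C c ∈ p.map (C : V →+* V[X]) ↔ c ∈ p :=
  ⟨fun h => by simpa using Ideal.mem_map_C_iff.1 h 0, fun h => Ideal.mem_map_of_mem C h⟩

theorem map_C_ne_bot {p : Ideal V} (hp : p ≠ ⊥) : p.map (C : V →+* V[X]) ≠ ⊥ := by
  rwa [Ne, Ideal.map_eq_bot_iff_of_injective C_injective]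

theorem map_C_injective : Function.Injective (Ideal.map (C : V →+* V[X])) := fun p q h => by
  ext c
  rw [← C_mem_map_C_iff, h, C_mem_map_C_iff]

/-- Pseudo-division by a nonzero element of least degree of an ideal of `V[X]`. -/
theorem exists_dvd_C_mul_of_minimal_natDegree [IsDomain V] {I : Ideal V[X]} {g : V[X]} (hg : g ∈ I)
    (hg0 : g ≠ 0) (hmin : ∀ f ∈ I, f ≠ 0 → g.natDegree ≤ f.natDegree) {f : V[X]} (hf : f ∈ I) :
    ∃ a ≠ 0, g ∣ C a * f := by
  induction hn : f.natDegree using Nat.strong_induction_on generalizing f with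
  | _ n ih =>
    by_cases hf0 : f = 0
    · exact ⟨1, one_ne_zero, by simp [hf0]⟩
    have hle := hmin f hf hf0
    rcases Nat.eq_zero_or_pos f.natDegree with h0 | hpos
    · have hgC := eq_C_of_natDegree_eq_zero (Nat.le_zero.1 (h0 ▸ hle))
      refine ⟨g.coeff 0, fun h => hg0 (by rw [hgC, h, C_0]), ?_⟩
      rw [← hgC]
      exact dvd_mul_right _ _
    · have hmem : g.cancelLeads f ∈ I :=
        I.sub_mem (I.mul_mem_left _ hf) (I.mul_mem_left _ hg)
      obtain ⟨a, ha, hd⟩ := ih _ (hn ▸ natDegree_cancelLeads_lt_of_natDegree_le_natDegree hle hpos)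
        hmem rfl
      refine ⟨a * g.leadingCoeff, mul_ne_zero ha (leadingCoeff_ne_zero.2 hg0), ?_⟩
      rw [cancelLeads, Nat.sub_eq_zero_of_le hle, pow_zero, mul_one, mul_sub] at hd
      rw [C_mul, mul_assoc]
      exact (dvd_sub_left (dvd_mul_of_dvd_right (dvd_mul_left _ _) _)).1 hd

end Primitive

/-! ### `t`-ideals of `V[X]` -/

section TIdeals

variable {V : Type*} [CommRing V] [IsDomain V] [ValuationRing V]

variable {K : Type*} [Field K] [Algebra V[X] K] [IsFractionRing V[X] K]

variable (K) in
/-- A primitive polynomial and a nonzero constant have trivial common denominators. -/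
theorem one_div_coeSubmodule_span_pair {g : V[X]} (hg : g.IsPrimitive) {a : V} (ha : a ≠ 0) :
    (1 : Submodule V[X] K) / coeSubmodule K (Ideal.span {g, C a}) = 1 := by
  have ha' : algebraMap V[X] K (C a) ≠ 0 := by simpa using ha
  refine le_antisymm (fun x hx => ?_) (Submodule.one_le_one_div.2 ?_)
  · obtain ⟨k, hk⟩ := Submodule.mem_one.1 (hx _ (algebraMap_mem_coeSubmodule.2
      (Ideal.subset_span (Set.mem_insert g {C a}))))
    obtain ⟨h, hh⟩ := Submodule.mem_one.1 (hx _ (algebraMap_mem_coeSubmodule.2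
      (Ideal.subset_span (Set.mem_insert_of_mem g (Set.mem_singleton (C a))))))
    have hgh : g * h = C a * k := by
      apply IsFractionRing.injective V[X] K
      rw [map_mul, map_mul, hk, hh]
      ring
    obtain ⟨l, rfl⟩ := C_dvd_of_C_dvd_isPrimitive_mul hg (Dvd.intro _ hgh.symm)
    refine Submodule.mem_one.2 ⟨l, mul_left_cancel₀ ha' ?_⟩
    rw [← map_mul, hh, mul_comm]
  · rw [← IsLocalization.coeSubmodule_top]
    exact IsLocalization.coeSubmodule_mono K le_top

theorem IsTIdeal.eq_top_of_mem_of_C_mem {I : Ideal V[X]} (hI : IsTIdeal K I) {g : V[X]}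
    (hg : g.IsPrimitive) (hgI : g ∈ I) {a : V} (ha : a ≠ 0) (haI : C a ∈ I) : I = ⊤ :=
  hI.eq_top_of_one_div_eq_one (Submodule.fg_span (Set.toFinite {g, C a}))
    (Ideal.span_le.2 (Set.pair_subset hgI haI)) (one_div_coeSubmodule_span_pair K hg ha)

variable (K) in
theorem isTIdeal_map_C {p : Ideal V} (hp : p ≠ ⊥) : IsTIdeal K (p.map (C : V →+* V[X])) := by
  refine ⟨map_C_ne_bot hp, tClosure_coeSubmodule_eq_of_directed (map_C_ne_bot hp) ?_⟩
  intro f hf g hg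
  obtain ⟨c, f', hf', rfl⟩ := exists_eq_C_mul_isPrimitive f
  obtain ⟨d, g', hg', rfl⟩ := exists_eq_C_mul_isPrimitive g
  rw [C_mul_mem_map_C_iff hf'] at hf
  rw [C_mul_mem_map_C_iff hg'] at hg
  rcases ValuationRing.dvd_total c d with h | h
  · exact ⟨C c, Ideal.mem_map_of_mem C hf, dvd_mul_right _ _, (map_dvd C h).mul_right _⟩
  · exact ⟨C d, Ideal.mem_map_of_mem C hg, (map_dvd C h).mul_right _, dvd_mul_right _ _⟩

/-- The `t`-primes of `V[X]` with a nonzero constant are extended from `V`; the others are generated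
by a primitive polynomial of positive degree. -/
theorem IsTPrime.eq_map_C_or_eq_span_singleton {P : Ideal V[X]} (hP : IsTPrime K P) :
    (∃ p : Ideal V, p.IsPrime ∧ p ≠ ⊥ ∧ P = p.map (C : V →+* V[X])) ∨
      ∃ g : V[X], g.IsPrimitive ∧ 0 < g.natDegree ∧ P = Ideal.span {g} := by
  obtain ⟨hprime, ht⟩ := hP
  by_cases hC : ∃ a ≠ 0, C a ∈ P
  · left
    obtain ⟨a, ha, haP⟩ := hC
    have ha' : a ∈ P.comap (C : V →+* V[X]) := haP
    refine ⟨P.comap C, Ideal.IsPrime.comap C, fun h => ha (by rwa [h] at ha'),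
      le_antisymm (fun f hf => ?_) Ideal.map_comap_le⟩
    obtain ⟨c, g, hg, rfl⟩ := exists_eq_C_mul_isPrimitive f
    rw [C_mul_mem_map_C_iff hg]
    exact (hprime.mem_or_mem hf).resolve_right fun hgP =>
      hprime.ne_top (ht.eq_top_of_mem_of_C_mem hg hgP ha haP)
  · right
    push Not at hC
    obtain ⟨f, ⟨hfP, hf0⟩, hfmin⟩ := exists_minimalFor_of_wellFoundedLT
      (fun f : V[X] => f ∈ P ∧ f ≠ 0) natDegree (Submodule.exists_mem_ne_zero_of_ne_bot ht.1)
    obtain ⟨c, g, hg, rfl⟩ := exists_eq_C_mul_isPrimitive f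
    have hc : c ≠ 0 := by rintro rfl; simp at hf0
    have hgP : g ∈ P := (hprime.mem_or_mem hfP).resolve_left (hC c hc)
    have hg0 : g ≠ 0 := right_ne_zero_of_mul hf0
    have hmin : ∀ f ∈ P, f ≠ 0 → g.natDegree ≤ f.natDegree := fun f hf hf0 => by
      rw [← natDegree_C_mul (a := c) (p := g) hc]
      exact (le_total _ _).elim id fun hle => hfmin ⟨hf, hf0⟩ hle
    refine ⟨g, hg, Nat.pos_of_ne_zero fun h => ?_, le_antisymm (fun f hf => ?_)
      ((Ideal.span_singleton_le_iff_mem P).2 hgP)⟩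
    · have hgC := eq_C_of_natDegree_eq_zero h
      exact hC (g.coeff 0) (fun h => hg0 (by rw [hgC, h, C_0])) (hgC ▸ hgP)
    · obtain ⟨a, ha, hd⟩ := exists_dvd_C_mul_of_minimal_natDegree hgP hg0 hmin hf
      exact Ideal.mem_span_singleton.2 (isPrimitive_dvd_of_dvd_C_mul ha hg hd)

variable (K) in
theorem isTPrime_map_C {p : Ideal V} [p.IsPrime] (hp : p ≠ ⊥) :
    IsTPrime K (p.map (C : V →+* V[X])) :=
  ⟨(Ideal.isPrime_map_C_iff_isPrime p).2 inferInstance, isTIdeal_map_C K hp⟩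

theorem isTIdempotent_map_C_iff {p : Ideal V} (hp : p ≠ ⊥) :
    IsTIdempotent K (p.map (C : V →+* V[X])) ↔ p ^ 2 = p := by
  have h2 : p ^ 2 ≠ ⊥ := pow_ne_zero 2 hp
  rw [IsTIdempotent, ← Ideal.map_pow, (isTIdeal_map_C K h2).2,
    (IsFractionRing.coeSubmodule_injective V[X] K).eq_iff, map_C_injective.eq_iff]
  exact and_iff_right (isTIdeal_map_C K hp)

/-- `(g)² = (g²)` is already a `t`-ideal. -/
theorem not_isTIdempotent_span_singleton {R : Type*} [CommRing R] [IsDomain R] {K : Type*} [Field K]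
    [Algebra R K] [IsFractionRing R K] {g : R} (hg0 : g ≠ 0) (hg : ¬ IsUnit g) :
    ¬ IsTIdempotent K (Ideal.span {g}) := by
  rintro ⟨-, h⟩
  rw [Ideal.span_singleton_pow, (isTIdeal_span_singleton K (pow_ne_zero 2 hg0)).2,
    (IsFractionRing.coeSubmodule_injective R K).eq_iff, Ideal.span_singleton_eq_span_singleton] at h
  obtain ⟨k, hk⟩ := h.dvd
  refine hg (IsUnit.of_mul_eq_one k (mul_left_cancel₀ hg0 ?_))
  linear_combination -hk

theorem isTPrime_and_isTIdempotent_iff {P : Ideal V[X]} :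
    (IsTPrime K P ∧ IsTIdempotent K P) ↔
      ∃ p : PrimeSpectrum V, p.asIdeal ≠ ⊥ ∧ p.asIdeal ^ 2 = p.asIdeal ∧
        P = p.asIdeal.map (C : V →+* V[X]) := by
  constructor
  · rintro ⟨hP, hidem⟩
    obtain ⟨p, hp, hp0, rfl⟩ | ⟨g, -, hdeg, rfl⟩ := hP.eq_map_C_or_eq_span_singleton
    · exact ⟨⟨p, hp⟩, hp0, (isTIdempotent_map_C_iff hp0).1 hidem, rfl⟩
    · exact absurd hidem (not_isTIdempotent_span_singleton (ne_zero_of_natDegree_gt hdeg)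
        (not_isUnit_of_natDegree_pos g hdeg))
  · rintro ⟨p, hp0, hidem, rfl⟩
    exact ⟨isTPrime_map_C K hp0, (isTIdempotent_map_C_iff hp0).2 hidem⟩

/-! ### `V[X]` is a Krull-type domain and not a Prüfer domain -/

theorem IsTMaximal.eq_map_C_or_eq_span_singleton (hV : ¬ IsField V) {M : Ideal V[X]}
    (hM : IsTMaximal K M) : M = (IsLocalRing.maximalIdeal V).map (C : V →+* V[X]) ∨
      ∃ g : V[X], 0 < g.natDegree ∧ M = Ideal.span {g} := by
  obtain ⟨p, hp, hp0, rfl⟩ | ⟨g, -, hg⟩ := hM.isTPrime.eq_map_C_or_eq_span_singleton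
  · left
    have hm := isTPrime_map_C K (IsLocalRing.isField_iff_maximalIdeal_eq.not.1 hV)
    exact hM.eq_of_le ⟨hm.1.ne_top, hm.2⟩ (Ideal.map_mono (IsLocalRing.le_maximalIdeal hp.ne_top))
  · exact Or.inr ⟨g, hg⟩

theorem finiteMultiplicity_of_natDegree_pos {R : Type*} [CommRing R] [IsDomain R] {g f : R[X]}
    (hg : 0 < g.natDegree) (hf : f ≠ 0) : FiniteMultiplicity g f := by
  refine ⟨f.natDegree, fun h => ?_⟩
  have := natDegree_le_of_dvd h hf
  rw [natDegree_pow] at this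
  nlinarith

/-- By induction on the degree of `f`: if `f = g * f'` with `(g)` prime, a principal prime through
`f` is `(g)` or passes through `f'`. -/
theorem finite_setOf_isPrime_span_singleton {R : Type*} [CommRing R] [IsDomain R] {f : R[X]}
    (hf : f ≠ 0) : {P : Ideal R[X] | P.IsPrime ∧ f ∈ P ∧
      ∃ g : R[X], 0 < g.natDegree ∧ P = Ideal.span {g}}.Finite := by
  induction hn : f.natDegree using Nat.strong_induction_on generalizing f with
  | _ n ih =>
    by_cases hP : ∃ g : R[X], (Ideal.span {g}).IsPrime ∧ g ∣ f ∧ 0 < g.natDegree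
    · obtain ⟨g, hg, ⟨f', rfl⟩, hdeg⟩ := hP
      have hf' : f' ≠ 0 := right_ne_zero_of_mul hf
      have hg0 : g ≠ 0 := left_ne_zero_of_mul hf
      rw [natDegree_mul hg0 hf'] at hn
      refine ((ih f'.natDegree (by omega) hf' rfl).insert (Ideal.span {g})).subset ?_
      rintro _ ⟨hprime, hmem, h, hh, rfl⟩
      rcases hprime.mem_or_mem hmem with hm | hm
      · left
        have hgp : Prime g := (Ideal.span_singleton_prime hg0).1 hg
        have hhp : Prime h := (Ideal.span_singleton_prime (ne_zero_of_natDegree_gt hh)).1 hprime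
        exact Ideal.span_singleton_eq_span_singleton.2
          (hhp.associated_of_dvd hgp (Ideal.mem_span_singleton.1 hm))
      · exact Or.inr ⟨hprime, hm, h, hh, rfl⟩
    · convert Set.finite_empty (α := Ideal R[X])
      refine Set.eq_empty_of_forall_notMem ?_
      rintro _ ⟨hprime, hmem, h, hh, rfl⟩
      exact hP ⟨h, hprime, Ideal.mem_span_singleton.1 hmem, hh⟩

variable (K) in
theorem isPVMD_polynomial (hV : ¬ IsField V) : IsPVMD V[X] K := by
  intro M hM
  have hprime := hM.isPrime
  refine ⟨hprime, ?_⟩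
  obtain rfl | ⟨g, hg, rfl⟩ := hM.eq_map_C_or_eq_span_singleton hV
  · refine valuationRing_localization_atPrime _ fun f g => ?_
    obtain ⟨c, f', hf', rfl⟩ := exists_eq_C_mul_isPrimitive f
    obtain ⟨d, g', hg', rfl⟩ := exists_eq_C_mul_isPrimitive g
    have hprim : ∀ {h : V[X]}, h.IsPrimitive →
        h ∉ (IsLocalRing.maximalIdeal V).map (C : V →+* V[X]) := fun {h} hh hmem => by
      obtain ⟨n, hn⟩ := exists_isUnit_coeff_of_isPrimitive hh
      exact Ideal.mem_map_C_iff.1 hmem n hn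
    rcases ValuationRing.dvd_total c d with ⟨k, rfl⟩ | ⟨k, rfl⟩
    · exact ⟨f', hprim hf', Or.inl ⟨C k * g', by rw [C_mul]; ring⟩⟩
    · exact ⟨g', hprim hg', Or.inr ⟨C k * f', by rw [C_mul]; ring⟩⟩
  · exact valuationRing_localization_span_singleton g
      fun f hf => finiteMultiplicity_of_natDegree_pos hg hf

variable (K) in
theorem hasFiniteTCharacter_polynomial (hV : ¬ IsField V) : HasFiniteTCharacter V[X] K := by
  intro I _ hI
  obtain ⟨f, hfI, hf⟩ := Submodule.exists_mem_ne_zero_of_ne_bot hI.1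
  refine ((finite_setOf_isPrime_span_singleton hf).insert
    ((IsLocalRing.maximalIdeal V).map (C : V →+* V[X]))).subset ?_
  rintro M ⟨hM, hIM⟩
  exact (hM.eq_map_C_or_eq_span_singleton hV).imp id fun h => ⟨hM.isPrime, hIM hfI, h⟩

/-- For a nonzero nonunit `a` of `V`, the ideal `(X, a)` has inverse `V[X]` but is proper. -/
theorem not_isPrueferDomain_polynomial (hV : ¬ IsField V) : ¬ IsPrueferDomain V[X] K := by
  intro h
  obtain ⟨a, ham, ha⟩ := Submodule.exists_mem_ne_zero_of_ne_bot
    (IsLocalRing.isField_iff_maximalIdeal_eq.not.1 hV)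
  let I : Ideal V[X] := Ideal.span {X, C a}
  have hXI : (X : V[X]) ∈ I := Ideal.subset_span (by simp)
  have hinv : (1 : Submodule V[X] K) / coeSubmodule K I = 1 :=
    one_div_coeSubmodule_span_pair K monic_X.isPrimitive ha
  obtain ⟨J, hJ⟩ := (h I (Submodule.fg_span (Set.toFinite _))
    (fun h0 => X_ne_zero (by rwa [h0] at hXI))).exists_right_inv
  have hJ1 : J ≤ 1 := by
    rw [← FractionalIdeal.coe_le_coe, FractionalIdeal.coe_one, ← hinv, Submodule.le_div_iff_mul_le,
      mul_comm, ← FractionalIdeal.coe_coeIdeal (S := V[X]⁰), ← FractionalIdeal.coe_mul, hJ,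
      FractionalIdeal.coe_one]
  have hI1 : (1 : FractionalIdeal V[X]⁰ K) ≤ I := by
    rw [← hJ]
    exact mul_le_of_le_one_right' hJ1
  rw [← FractionalIdeal.coeIdeal_top, FractionalIdeal.coeIdeal_le_coeIdeal, top_le_iff,
    Ideal.eq_top_iff_one, Ideal.mem_span_pair] at hI1
  obtain ⟨u, v, huv⟩ := hI1
  have := congrArg (coeff · 0) huv
  simp only [coeff_add, mul_coeff_zero, coeff_X_zero, mul_zero, zero_add, coeff_C_zero,
    coeff_one_zero] at this
  exact ham (IsUnit.of_mul_eq_one_right _ this)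

end TIdeals

/-! ### Fractional `t`-linked overrings of `V[X]` -/

section AlmostIntegral

variable {V : Type*} [CommRing V] [IsDomain V]
variable {K : Type*} [Field K] [Algebra V[X] K] [IsFractionRing V[X] K]

/-- An element of `K` which is almost integral over `V[X]` up to nonzero constants is a polynomial
up to a nonzero constant. Take a denominator `w` of `t` of least degree. Since every `d * t ^ n` is
up to constants a denominator of `t`, it is divisible by `w` up to constants, so `d / w` inherits
the hypothesis on `d`; if `w` were not constant, this would go on forever. -/
theorem exists_mul_C_eq_of_forall_mul_pow {t : K} {d : V[X]} (hd : d ≠ 0)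
    (h : ∀ n : ℕ, ∃ a ≠ 0, ∃ e : V[X], algebraMap V[X] K (C a * d) * t ^ n = algebraMap V[X] K e) :
    ∃ b ≠ 0, ∃ f : V[X], t * algebraMap V[X] K (C b) = algebraMap V[X] K f := by
  let I : Ideal V[X] :=
    (1 : Submodule V[X] K).comap ((LinearMap.mulRight V[X] t).comp (Algebra.linearMap V[X] K))
  have hI : ∀ w, w ∈ I ↔ ∃ e, algebraMap V[X] K e = algebraMap V[X] K w * t :=
    fun w => Submodule.mem_one
  have hne : ∃ w, w ∈ I ∧ w ≠ 0 := by
    obtain ⟨u, w, hw, rfl⟩ := IsFractionRing.div_surjective (A := V[X]) t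
    have hw0 := nonZeroDivisors.ne_zero hw
    have hw' : algebraMap V[X] K w ≠ 0 := by simpa using hw0
    exact ⟨w, (hI w).2 ⟨u, by field_simp⟩, hw0⟩
  obtain ⟨w, ⟨hwI, hw0⟩, hwmin⟩ := exists_minimalFor_of_wellFoundedLT
    (fun w : V[X] => w ∈ I ∧ w ≠ 0) natDegree hne
  have hmin : ∀ f ∈ I, f ≠ 0 → w.natDegree ≤ f.natDegree := fun f hf hf0 =>
    (le_total w.natDegree f.natDegree).elim id fun hle => hwmin ⟨hf, hf0⟩ hle
  rcases Nat.eq_zero_or_pos w.natDegree with hdeg | hdeg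
  · have hwC := eq_C_of_natDegree_eq_zero hdeg
    obtain ⟨e, he⟩ := (hI w).1 hwI
    exact ⟨w.coeff 0, fun h => hw0 (by rw [hwC, h, C_0]), e, by rw [← hwC, he, mul_comm]⟩
  · exfalso
    have hw' : algebraMap V[X] K w ≠ 0 := by simpa using hw0
    -- every `d * t ^ n` is divisible by `w`, up to a constant
    have hdvd : ∀ d : V[X], (∀ n : ℕ, ∃ a ≠ 0, ∃ e : V[X],
        algebraMap V[X] K (C a * d) * t ^ n = algebraMap V[X] K e) → ∀ n : ℕ, ∃ a ≠ 0, ∃ e : V[X],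
          algebraMap V[X] K (C a * d) * t ^ n = algebraMap V[X] K (w * e) := by
      intro d h n
      obtain ⟨a, ha, e, he⟩ := h n
      obtain ⟨a', ha', e', he'⟩ := h (n + 1)
      have hmem : C a' * e ∈ I := by
        refine (hI _).2 ⟨C a * e', ?_⟩
        rw [map_mul, ← he', map_mul _ (C a') e, ← he, map_mul, map_mul]
        ring
      obtain ⟨b, hb, k, hk⟩ := exists_dvd_C_mul_of_minimal_natDegree hwI hw0 hmin hmem
      refine ⟨b * a' * a, mul_ne_zero (mul_ne_zero hb ha') ha, k, ?_⟩
      rw [← hk, map_mul _ (C b), map_mul _ (C a') e, ← he]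
      simp only [map_mul]
      ring
    induction hn : d.natDegree using Nat.strong_induction_on generalizing d with
    | _ n ih =>
      obtain ⟨b, hb, d', hd'⟩ := hdvd d h 0
      rw [pow_zero, mul_one] at hd'
      have hd'' := IsFractionRing.injective V[X] K hd'
      have hd0 : d' ≠ 0 := by
        rintro rfl
        rw [mul_zero] at hd''
        exact mul_ne_zero (C_ne_zero.2 hb) hd hd''
      have hdeg' : d'.natDegree < n := by
        have := congrArg natDegree hd''
        rw [natDegree_C_mul hb, natDegree_mul hw0 hd0] at this
        omega
      refine ih _ hdeg' hd0 (fun m => ?_) rfl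
      obtain ⟨a, ha, e, he⟩ := hdvd d h m
      refine ⟨a, ha, C b * e, mul_left_cancel₀ hw' ?_⟩
      simp only [map_mul] at hd' he ⊢
      linear_combination (-(algebraMap V[X] K (C a)) * t ^ m) * hd' + algebraMap V[X] K (C b) * he

theorem IsFractionalOverring.exists_mul_C_eq {T : Subalgebra V[X] K} (hT : IsFractionalOverring T)
    {t : K} (ht : t ∈ T) :
    ∃ b ≠ 0, ∃ f : V[X], t * algebraMap V[X] K (C b) = algebraMap V[X] K f := by
  obtain ⟨d, hd, h⟩ := hT
  refine exists_mul_C_eq_of_forall_mul_pow (nonZeroDivisors.ne_zero hd) fun n => ?_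
  obtain ⟨e, he⟩ := h (t ^ n) (T.pow_mem ht n)
  exact ⟨1, one_ne_zero, e, by rw [he, C_1, one_mul, Algebra.smul_def]⟩

end AlmostIntegral

section Overring

variable {V : Type*} [CommRing V] {K : Type*} [Field K] [Algebra V[X] K] [IsFractionRing V[X] K]

theorem mem_localizedPolynomialRing {p : Ideal V} [p.IsPrime] {x : K} :
    x ∈ localizedPolynomialRing K p ↔
      ∃ s ∉ p, ∃ f : V[X], x * algebraMap V[X] K (C s) = algebraMap V[X] K f := by
  have hmap : ∀ f : V[X], localizedPolynomialMap K p
      (f.map (algebraMap V (Localization.AtPrime p))) = algebraMap V[X] K f := by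
    intro f
    refine RingHom.congr_fun (f := (localizedPolynomialMap K p).comp (mapRingHom _))
      (ringHom_ext (fun a => ?_) ?_) f
    · simp [localizedPolynomialMap]
    · simp [localizedPolynomialMap]
  constructor
  · rintro ⟨q, rfl⟩
    obtain ⟨s, hs, hsq⟩ := IsLocalization.integerNormalization_spec p.primeCompl q
    refine ⟨s, hs, IsLocalization.integerNormalization p.primeCompl q, ?_⟩
    rw [← hmap (IsLocalization.integerNormalization p.primeCompl q), hsq, ← hmap (C s), ← map_mul,
      map_C, mul_comm, ← smul_eq_C_mul, algebraMap_smul]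
  · rintro ⟨s, hs, f, h⟩
    obtain ⟨s, rfl⟩ : ∃ s' : p.primeCompl, (s' : V) = s := ⟨⟨s, hs⟩, rfl⟩
    have hs0 : algebraMap V[X] K (C (s : V)) ≠ 0 := (isUnit_const K p s).ne_zero
    refine ⟨C (IsLocalization.mk' _ 1 s) * f.map (algebraMap V _), mul_right_cancel₀ hs0 ?_⟩
    rw [h, ← hmap (C (s : V)), ← map_mul, ← hmap f, map_C]
    congr 1
    rw [mul_right_comm, ← C_mul, IsLocalization.mk'_spec, map_one, C_1, one_mul]

/-- The constants not invertible in an overring of `V[X]` form a prime ideal of `V`: they are the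
trace on `V` of the maximal ideal of a valuation overring. -/
theorem exists_primeSpectrum_notMem_iff [IsDomain V] [ValuationRing V] (T : Subalgebra V[X] K) :
    ∃ p : PrimeSpectrum V,
      ∀ s, s ∉ p.asIdeal ↔ s ≠ 0 ∧ (algebraMap V[X] K (C s))⁻¹ ∈ T := by
  have hne : ∀ {s : V}, s ≠ 0 → algebraMap V[X] K (C s) ≠ 0 := fun {s} hs => by simpa using hs
  have hmul : ∀ r s : V, r * s ≠ 0 ∧ (algebraMap V[X] K (C (r * s)))⁻¹ ∈ T →
      s ≠ 0 ∧ (algebraMap V[X] K (C s))⁻¹ ∈ T := by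
    rintro r s ⟨h0, h⟩
    have hr := hne (left_ne_zero_of_mul h0)
    refine ⟨right_ne_zero_of_mul h0, ?_⟩
    convert T.mul_mem (T.algebraMap_mem (C r)) h using 1
    rw [C_mul, map_mul, mul_inv, mul_inv_cancel_left₀ hr]
  let p : Ideal V :=
    { carrier := {s | ¬ (s ≠ 0 ∧ (algebraMap V[X] K (C s))⁻¹ ∈ T)}
      zero_mem' := fun h => h.1 rfl
      smul_mem' := fun r s hs h => hs (hmul r s h)
      add_mem' := fun {a b} ha hb h => by
        rcases ValuationRing.dvd_total a b with ⟨k, rfl⟩ | ⟨k, rfl⟩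
        · exact ha (hmul (1 + k) a (by rwa [show (1 + k) * a = a + a * k by ring]))
        · exact hb (hmul (1 + k) b (by rwa [show (1 + k) * b = b * k + b by ring])) }
  have hp : ∀ s, s ∉ p ↔ s ≠ 0 ∧ (algebraMap V[X] K (C s))⁻¹ ∈ T := fun s => not_not
  refine ⟨⟨p, ⟨?_, fun {a b} hab => ?_⟩⟩, hp⟩
  · rw [Ideal.ne_top_iff_one, hp]
    exact ⟨one_ne_zero, by simp [T.one_mem]⟩
  · by_contra! h
    rw [hp, hp] at h
    refine (hp _).2 ⟨mul_ne_zero h.1.1 h.2.1, ?_⟩ hab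
    rw [C_mul, map_mul, mul_inv]
    exact T.mul_mem h.1.2 h.2.2

variable [IsDomain V]

/-- In a `t`-linked overring, a fraction `g / a` with `g` primitive has its denominator invertible,
because `1 / a` multiplies the ideal `(g, a)`, whose inverse is `V[X]`, into the overring. -/
theorem IsTLinked.inv_mem [ValuationRing V] {T : Subalgebra V[X] K} (hT : IsTLinked T) {g : V[X]}
    (hg : g.IsPrimitive) {a : V} (ha : a ≠ 0)
    (h : algebraMap V[X] K g * (algebraMap V[X] K (C a))⁻¹ ∈ T) :
    (algebraMap V[X] K (C a))⁻¹ ∈ T := by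
  have ha' : algebraMap V[X] K (C a) ≠ 0 := by simpa using ha
  rw [← Subalgebra.mem_toSubmodule, ← hT (Ideal.span {g, C a})
    (Submodule.fg_span (Set.toFinite _)) (one_div_coeSubmodule_span_pair K hg ha)]
  intro y hy
  refine Submodule.mul_induction_on hy (fun i hi t ht => ?_) fun y z hy hz => ?_
  · obtain ⟨k, hk, rfl⟩ := (mem_coeSubmodule K _).1 hi
    obtain ⟨u, v, rfl⟩ := Ideal.mem_span_pair.1 hk
    have : (algebraMap V[X] K (C a))⁻¹ * (algebraMap V[X] K (u * g + v * C a) * t) =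
        (algebraMap V[X] K u * (algebraMap V[X] K g * (algebraMap V[X] K (C a))⁻¹) +
          algebraMap V[X] K v) * t := by
      rw [map_add, map_mul, map_mul]
      field_simp
    rw [this]
    exact T.mul_mem (T.add_mem (T.mul_mem (T.algebraMap_mem u) h) (T.algebraMap_mem v)) ht
  · rw [mul_add]
    exact T.add_mem hy hz

theorem exists_toSubring_eq_localizedPolynomialRing [ValuationRing V] (hV : ¬ IsField V)
    {T : Subalgebra V[X] K} (hT : IsFractionalOverring T) (hT' : IsTLinked T) :
    ∃ p : PrimeSpectrum V, p.asIdeal ≠ ⊥ ∧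
      T.toSubring = localizedPolynomialRing K p.asIdeal := by
  obtain ⟨p, hp⟩ := exists_primeSpectrum_notMem_iff T
  refine ⟨p, fun hbot => ?_, ?_⟩
  · -- otherwise every nonzero constant divides a common denominator `d` of `T`
    obtain ⟨d, hd, h⟩ := hT
    have hd0 := nonZeroDivisors.ne_zero hd
    have hdvd : ∀ a : V, a ≠ 0 → C a ∣ d := fun a ha => by
      have ha' : algebraMap V[X] K (C a) ≠ 0 := by simpa using ha
      obtain ⟨e, he⟩ := h _ ((hp a).1 (by simpa [hbot] using ha)).2
      refine ⟨e, IsFractionRing.injective V[X] K ?_⟩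
      rw [map_mul, he, Algebra.smul_def]
      field_simp
    obtain ⟨m, hm, hm0⟩ := Submodule.exists_mem_ne_zero_of_ne_bot
      (IsLocalRing.isField_iff_maximalIdeal_eq.not.1 hV)
    have hl := leadingCoeff_ne_zero.2 hd0
    obtain ⟨k, hk⟩ := C_dvd_iff_dvd_coeff _ _ |>.1 (hdvd _ (mul_ne_zero hl hm0)) d.natDegree
    refine hm (IsUnit.of_mul_eq_one k (mul_left_cancel₀ hl ?_))
    rw [coeff_natDegree] at hk
    rw [← mul_assoc, ← hk, mul_one]
  · ext x
    rw [mem_localizedPolynomialRing, Subalgebra.mem_toSubring]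
    constructor
    · intro hx
      obtain ⟨b, hb, f, hf⟩ := hT.exists_mul_C_eq hx
      have hb' : algebraMap V[X] K (C b) ≠ 0 := by simpa using hb
      obtain ⟨c, g, hg, rfl⟩ := exists_eq_C_mul_isPrimitive f
      rcases ValuationRing.dvd_total b c with ⟨a, rfl⟩ | ⟨a, rfl⟩
      · refine ⟨1, (Ideal.ne_top_iff_one _).1 p.2.ne_top, C a * g, mul_right_cancel₀ hb' ?_⟩
        rw [C_1, map_one, mul_one, hf]
        simp only [map_mul]
        ring
      · have ha := right_ne_zero_of_mul hb
        have hc := left_ne_zero_of_mul hb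
        have ha' : algebraMap V[X] K (C a) ≠ 0 := by simpa using ha
        have hc' : algebraMap V[X] K (C c) ≠ 0 := by simpa using hc
        have hxa : x * algebraMap V[X] K (C a) = algebraMap V[X] K g := by
          refine mul_left_cancel₀ hc' ?_
          simp only [map_mul] at hf
          linear_combination hf
        refine ⟨a, (hp a).2 ⟨ha, hT'.inv_mem hg ha ?_⟩, g, hxa⟩
        rwa [← hxa, mul_inv_cancel_right₀ ha']
    · rintro ⟨s, hs, f, h⟩
      obtain ⟨hs0, hsT⟩ := (hp s).1 hs
      have hs' : algebraMap V[X] K (C s) ≠ 0 := by simpa using hs0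
      rw [← mul_inv_cancel_right₀ hs' x, h]
      exact T.mul_mem (T.algebraMap_mem f) hsT

theorem isFractionalOverring_of_toSubring_eq [ValuationRing V] {T : Subalgebra V[X] K}
    {p : Ideal V} [p.IsPrime] (hp : p ≠ ⊥) (hT : T.toSubring = localizedPolynomialRing K p) :
    IsFractionalOverring T := by
  obtain ⟨d, hd, hd0⟩ := Submodule.exists_mem_ne_zero_of_ne_bot hp
  refine ⟨C d, mem_nonZeroDivisors_of_ne_zero (C_ne_zero.2 hd0), fun x hx => ?_⟩
  have hx' : x ∈ T.toSubring := hx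
  rw [hT, mem_localizedPolynomialRing] at hx'
  obtain ⟨s, hs, f, h⟩ := hx'
  obtain ⟨k, rfl⟩ : s ∣ d := (ValuationRing.dvd_total s d).resolve_right
    fun ⟨k, hk⟩ => hs (hk ▸ p.mul_mem_right k hd)
  refine ⟨C k * f, ?_⟩
  rw [Algebra.smul_def, map_mul, ← h, C_mul, map_mul]
  ring

/-- If `x` multiplies a finitely generated `I` into `V_p[X]`, then `s x` multiplies `I` into `V[X]`
for some `s ∉ p`. -/
theorem isTLinked_of_toSubring_eq {T : Subalgebra V[X] K} {p : Ideal V} [hp : p.IsPrime]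
    (hT : T.toSubring = localizedPolynomialRing K p) : IsTLinked T := by
  have hmem : ∀ x, x ∈ T ↔ ∃ s ∉ p, ∃ f : V[X],
      x * algebraMap V[X] K (C s) = algebraMap V[X] K f := fun x => by
    rw [← Subalgebra.mem_toSubring, hT, mem_localizedPolynomialRing]
  rintro I ⟨S, rfl⟩ hI
  refine le_antisymm (fun x hx => ?_) (fun x hx y hy => ?_)
  · have hxS : ∀ i ∈ S, ∃ s ∉ p, ∃ f : V[X],
        x * algebraMap V[X] K i * algebraMap V[X] K (C s) = algebraMap V[X] K f := fun i hi => by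
      rw [← hmem]
      refine hx _ ?_
      rw [← mul_one (algebraMap V[X] K i)]
      exact Submodule.mul_mem_mul (algebraMap_mem_coeSubmodule.2 (Ideal.subset_span hi)) T.one_mem
    choose! s hs f hf using hxS
    have hprod : ∏ i ∈ S, s i ∉ p := by
      rw [hp.prod_mem_iff]
      push Not
      exact hs
    have hxs : x * algebraMap V[X] K (C (∏ i ∈ S, s i)) ∈ (1 : Submodule V[X] K) := by
      rw [← hI]
      intro y hy
      obtain ⟨k, hk, rfl⟩ := (mem_coeSubmodule K _).1 hy
      clear hy
      induction hk using Submodule.span_induction with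
      | mem i hi =>
        obtain ⟨r, hr⟩ := Finset.dvd_prod_of_mem s hi
        refine Submodule.mem_one.2 ⟨f i * C r, ?_⟩
        rw [hr, map_mul, ← hf i hi, C_mul, map_mul]
        ring
      | zero => rw [map_zero, mul_zero]; exact zero_mem _
      | add k l _ _ hk hl =>
        rw [map_add, mul_add]
        exact add_mem hk hl
      | smul r k _ hk =>
        rw [smul_eq_mul, map_mul, mul_left_comm, ← Algebra.smul_def]
        exact Submodule.smul_mem _ r hk
    obtain ⟨g, hg⟩ := Submodule.mem_one.1 hxs
    exact (hmem x).2 ⟨_, hprod, g, hg.symm⟩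
  · refine Submodule.mul_induction_on hy (fun i hi t ht => ?_) fun y z hy hz => ?_
    · obtain ⟨k, -, rfl⟩ := (mem_coeSubmodule K _).1 hi
      exact T.mul_mem hx (T.mul_mem (T.algebraMap_mem k) ht)
    · rw [mul_add]
      exact T.add_mem hy hz

end Overring

end TOp

theorem lemma3p1 {V : Type*} [CommRing V] [IsDomain V] [ValuationRing V] (hV : ¬ IsField V)
    {K : Type*} [Field K] [Algebra V[X] K] [IsFractionRing V[X] K] :
    (TOp.IsKrullType V[X] K ∧ ¬ TOp.IsPrueferDomain V[X] K) ∧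
    (∀ T : Subalgebra V[X] K,
      (TOp.IsFractionalOverring T ∧ TOp.IsTLinked T) ↔
        ∃ p : PrimeSpectrum V, p.asIdeal ≠ ⊥ ∧
          T.toSubring = TOp.localizedPolynomialRing K p.asIdeal) ∧
    (∀ P : Ideal V[X],
      (TOp.IsTPrime K P ∧ TOp.IsTIdempotent K P) ↔
        ∃ p : PrimeSpectrum V, p.asIdeal ≠ ⊥ ∧ p.asIdeal ^ 2 = p.asIdeal ∧
          P = p.asIdeal.map (C : V →+* V[X])) := by
  refine ⟨⟨⟨TOp.isPVMD_polynomial K hV, TOp.hasFiniteTCharacter_polynomial K hV⟩,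
    TOp.not_isPrueferDomain_polynomial hV⟩, fun T => ⟨fun h => ?_, ?_⟩,
    fun P => TOp.isTPrime_and_isTIdempotent_iff⟩
  · exact TOp.exists_toSubring_eq_localizedPolynomialRing hV h.1 h.2
  · rintro ⟨p, hp, hT⟩
    exact ⟨TOp.isFractionalOverring_of_toSubring_eq hp hT, TOp.isTLinked_of_toSubring_eq hT⟩
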